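/- For $n \ge 2$, let $L_n$ be the triplet group $$L_n = \langle y_1, \ldots, y_{n-1} \mid y_j^2 = 1 \ (1 \le j \le n-1),\ \ y_i y_{i+1} y_i = y_{i+1} y_i y_{i+1} \ (1 \le i \le n-2) \rangle,$$ and let the pure triplet group $PL_n$ be the kernel of the natural surjection $L_n \to S_n$ onto the symmetric group that sends $y_i$ to the adjacent transposition $(i\ \ i+1)$. Then, for every $n \ge 4$, the group $PL_n$ is isomorphic to the free group of rank $$1 + n!\left(\frac{2n-7}{6}\right).$$ In particular, $PL_4$ is free of rank $5$ and $PL_5$ is free of rank $61$. -/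

import Mathlib

/-- The defining relators of the triplet group `L_n`, as words in the free group on the letters
`y_0, …, y_{n-2}` (the standard letters `y_1, …, y_{n-1}`, shifted by one):
`y_j ^ 2` for every `j`, and `(y_i y_{i+1} y_i) (y_{i+1} y_i y_{i+1})⁻¹` for every pair of
consecutive indices. -/
def tripletRels (n : ℕ) : Set (FreeGroup (Fin (n - 1))) :=
  {w | ∃ j : Fin (n - 1), w = FreeGroup.of j ^ 2} ∪
  {w | ∃ i j : Fin (n - 1), (i : ℕ) + 1 = (j : ℕ) ∧
    w = (FreeGroup.of i * FreeGroup.of j * FreeGroup.of i) *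
      (FreeGroup.of j * FreeGroup.of i * FreeGroup.of j)⁻¹}

/-- The triplet group `L_n`, given by its presentation. -/
abbrev TripletGroup (n : ℕ) : Type := PresentedGroup (tripletRels n)

/-- The adjacent transposition of `S_n` that exchanges the points `i` and `i + 1`
(points are numbered from `0` to `n - 1`). -/
def adjSwap (n : ℕ) (i : Fin (n - 1)) : Equiv.Perm (Fin n) :=
  Equiv.swap ⟨i, by omega⟩ ⟨i + 1, by omega⟩

/-- The adjacent transpositions satisfy the relations of the triplet group. -/
theorem adjSwap_rels (n : ℕ) :
    ∀ w ∈ tripletRels n, FreeGroup.lift (adjSwap n) w = 1 := by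
  rintro w (⟨j, rfl⟩ | ⟨i, j, hij, rfl⟩)
  · simp [adjSwap, pow_two]
  · simp only [map_mul, map_inv, FreeGroup.lift_apply_of, mul_inv_eq_one]
    have hi := i.isLt
    have hj := j.isLt
    have e : adjSwap n j = Equiv.swap ⟨i + 1, by omega⟩ ⟨i + 2, by omega⟩ := by
      simp only [adjSwap]
      congr 2 <;> omega
    have key : ∀ a b c : Fin n, a ≠ b → a ≠ c → b ≠ c →
        Equiv.swap a b * Equiv.swap b c * Equiv.swap a b =
          Equiv.swap b c * Equiv.swap a b * Equiv.swap b c := by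
      intro a b c hab hac hbc
      rw [Equiv.swap_mul_swap_mul_swap hab hac, Equiv.swap_comm a b, Equiv.swap_comm b c,
        Equiv.swap_mul_swap_mul_swap hbc.symm hac.symm, Equiv.swap_comm]
    rw [e, adjSwap]
    exact key _ _ _ (by simp) (by simp) (by simp)

/-- The natural homomorphism `L_n → S_n` that sends each generator to the corresponding
adjacent transposition. -/
def tripletToPerm (n : ℕ) : TripletGroup n →* Equiv.Perm (Fin n) :=
  PresentedGroup.toGroup (adjSwap_rels n)

/-- The pure triplet group `PL_n`, the kernel of the natural homomorphism `L_n → S_n`. -/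
abbrev PureTripletGroup (n : ℕ) : Subgroup (TripletGroup n) := (tripletToPerm n).ker

/-!
The products `y_i y_{i+1}` have order three, and they generate the even subgroup of `L_n` as a free
product of `n - 2` copies of `ℤ/3`: the group `L_n` acts on this free product in such a way that
`y_i y_{i+1}` acts by translation by the generator of the `i`-th factor. The pure triplet group is
a subgroup of index `n! / 2` of the free product, and it meets the conjugates of the factors only
in `1`.

A subgroup `H` of finite index with the latter property in a free product of finitely many groups
`G i` is a vertex group of the action groupoid on the cosets of `H`. Each `G i` acts freely on the
cosets, and the groupoid is freely generated by the arrows that lead, in each orbit of each `G i`,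
from one point to the others. So `H` is free, of rank `1 - #vertices + #arrows`, which is
`1 + d (∑ i, (1 - 1 / |G i|) - 1)` for `H` of index `d`.
-/

open CategoryTheory

universe u

noncomputable section VertexGroup

variable {C : Type u} [Groupoid.{u} C] {r : C} {X : Type u} [Group X]

/-- The loop at `r` obtained from an arrow of a groupoid by moving its endpoints to `r` along a
choice `t` of arrows. -/
def loopAt (t : ∀ a, r ⟶ a) {a b : C} (p : a ⟶ b) : End r := t a ≫ p ≫ inv (t b)

lemma loopAt_id (t : ∀ a, r ⟶ a) (a : C) : loopAt t (𝟙 a) = 1 := by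
  simp [loopAt, End.one_def]

lemma loopAt_comp (t : ∀ a, r ⟶ a) {a b c : C} (p : a ⟶ b) (q : b ⟶ c) :
    loopAt t (p ≫ q) = loopAt t q * loopAt t p := by
  simp [loopAt, End.mul_def]

lemma loopAt_choice {t : ∀ a, r ⟶ a} (ht : t r = 𝟙 r) (a : C) : loopAt t (t a) = 1 := by
  simp [loopAt, ht, End.one_def]

lemma loopAt_end {t : ∀ a, r ⟶ a} (ht : t r = 𝟙 r) (p : End r) : loopAt t p = p := by
  simp [loopAt, ht]

/-- The functor into a group that extends a homomorphism on the vertex group at `r` and takes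
prescribed values `f a` on the arrows `t a`. -/
def functorOfEndHom (t : ∀ a, r ⟶ a) (φ : End r →* X) (f : C → X) : C ⥤ SingleObj X where
  obj _ := SingleObj.star X
  map {a b} p := (f b * φ (loopAt t p) * (f a)⁻¹ : X)
  map_id a := by
    rw [loopAt_id, map_one, mul_one, mul_inv_cancel, SingleObj.id_as_one]
  map_comp p q := by
    rw [loopAt_comp, map_mul, SingleObj.comp_as_mul]
    group

/-- Functors from a connected groupoid to a group, in coordinates: the restriction to the vertex
group at `r`, and the values on a tree of arrows `t a : r ⟶ a`. -/
def functorEquivEndHomProd {t : ∀ a, r ⟶ a} (ht : t r = 𝟙 r) :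
    (C ⥤ SingleObj X) ≃ (End r →* X) × {f : C → X // f r = 1} where
  toFun F := ⟨F.mapEnd r, fun a => F.map (t a), (congrArg F.map ht).trans (F.map_id r)⟩
  invFun p := functorOfEndHom t p.1 p.2
  left_inv F := by
    refine Functor.hext (fun _ => rfl) fun a b p => heq_of_eq ?_
    change (F.map (t b) * F.map (t a ≫ p ≫ inv (t b)) * (F.map (t a))⁻¹ : X) = F.map p
    rw [F.map_comp, F.map_comp, F.map_inv, SingleObj.comp_as_mul, SingleObj.comp_as_mul,
      SingleObj.inv_as_inv]
    group
  right_inv := by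
    rintro ⟨φ, f, hf⟩
    refine Prod.ext (MonoidHom.ext fun p => ?_) (Subtype.ext <| funext fun a => ?_)
    · change f r * φ (loopAt t p) * (f r)⁻¹ = φ p
      simp [hf, loopAt_end ht]
    · change f a * φ (loopAt t (t a)) * (f r)⁻¹ = f a
      rw [loopAt_choice ht, map_one, hf, mul_one, inv_one, mul_one]

lemma nonempty_functorEquivEndHomProd [IsConnected C] (r : C) (X : Type u) [Group X] :
    Nonempty ((C ⥤ SingleObj X) ≃ (End r →* X) × {f : C → X // f r = 1}) := by
  classical
  let t : ∀ a, r ⟶ a := Function.update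
    (fun a => (nonempty_hom_of_preconnected_groupoid r a).some) r (𝟙 r)
  exact ⟨functorEquivEndHomProd (t := t) (Function.update_self ..)⟩

/-- A functor from a free groupoid to a group is a labelling of the generating arrows. -/
def functorEquivLabelling [IsFreeGroupoid C] (X : Type u) [Group X] :
    (C ⥤ SingleObj X) ≃ (Quiver.Total (IsFreeGroupoid.Generators C) → X) :=
  Equiv.ofBijective (fun F e => (F.map (IsFreeGroupoid.of e.hom) : X)) <|
    Function.bijective_iff_existsUnique _ |>.2 fun l => by
      obtain ⟨F, hF, hu⟩ := IsFreeGroupoid.unique_lift (G := C) fun a b e => l ⟨a, b, e⟩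
      exact ⟨F, funext fun e => hF _ _ _, fun F' h => hu _ fun a b e => congrFun h ⟨a, b, e⟩⟩

lemma card_subtype_apply_eq_one_mul_card {α : Type*} [Finite α] (a : α) (X : Type*) [Group X] :
    Nat.card {f : α → X // f a = 1} * Nat.card X = Nat.card X ^ Nat.card α := by
  let e : {f : α → X // f a = 1} × X ≃ (α → X) :=
    { toFun := fun p b => p.1.1 b * p.2
      invFun := fun f => (⟨fun b => f b * (f a)⁻¹, mul_inv_cancel _⟩, f a)
      left_inv := by
        rintro ⟨⟨f, hf⟩, x⟩
        simp [hf]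
      right_inv := fun f => by simp }
  rw [← Nat.card_prod, Nat.card_congr e, Nat.card_fun]

/-- The rank is read off by counting the homomorphisms to a group of order two. -/
theorem exists_end_mulEquiv_freeGroup [IsConnected C] [IsFreeGroupoid C] [Finite C]
    [Finite (Quiver.Total (IsFreeGroupoid.Generators C))] (r : C) :
    ∃ k : ℕ, k + Nat.card C = Nat.card (Quiver.Total (IsFreeGroupoid.Generators C)) + 1 ∧
      Nonempty (End r ≃* FreeGroup (Fin k)) := by
  let X : Type u := ULift (Multiplicative (ZMod 2))
  let ι := IsFreeGroup.Generators (End r)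
  have hX : Nat.card X = 2 := by simp [X]
  obtain ⟨e⟩ := nonempty_functorEquivEndHomProd r X
  let e' : (ι → X) × {f : C → X // f r = 1} ≃
      (Quiver.Total (IsFreeGroupoid.Generators C) → X) :=
    (Equiv.prodCongr IsFreeGroup.lift (Equiv.refl _)).trans
      (e.symm.trans (functorEquivLabelling X))
  have : Finite ((ι → X) × {f : C → X // f r = 1}) := .of_equiv _ e'.symm
  have : Nonempty {f : C → X // f r = 1} := ⟨1, rfl⟩
  have : Finite (ι → X) := Finite.prod_left {f : C → X // f r = 1}
  have : Finite ι := not_infinite_iff_finite.1 fun _ => not_finite (ι → X)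
  have hcard : 2 ^ (Nat.card ι + Nat.card C) =
      2 ^ (Nat.card (Quiver.Total (IsFreeGroupoid.Generators C)) + 1) := by
    rw [pow_add, pow_succ, ← hX, ← card_subtype_apply_eq_one_mul_card r X, ← mul_assoc,
      ← Nat.card_fun, ← Nat.card_prod, Nat.card_congr e', Nat.card_fun]
  exact ⟨Nat.card ι, Nat.pow_right_injective le_rfl hcard,
    ⟨(IsFreeGroup.toFreeGroup (End r)).trans (FreeGroup.freeGroupCongr (Finite.equivFin ι))⟩⟩

end VertexGroup

section EquivariantMap

variable {G A : Type*} [Group G] [MulAction G A]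

lemma exists_equivariant_of_free (h : ∀ (g : G) (a : A), g • a = a → g = 1) :
    ∃ σ : A → G, ∀ g a, σ (g • a) = g * σ a := by
  have hex (a : A) : ∃ g : G, g • (Quotient.mk (MulAction.orbitRel G A) a).out = a :=
    MulAction.orbitRel_apply.1 ((MulAction.orbitRel G A).symm (Quotient.mk_out a))
  choose σ hσ using hex
  refine ⟨σ, fun g a => ?_⟩
  have horbit : Quotient.mk (MulAction.orbitRel G A) (g • a) = Quotient.mk _ a :=
    Quotient.sound ⟨g, rfl⟩
  have hfix : ((g * σ a)⁻¹ * σ (g • a)) • (Quotient.mk (MulAction.orbitRel G A) a).out =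
      (Quotient.mk (MulAction.orbitRel G A) a).out := by
    rw [mul_smul, ← horbit, hσ, inv_smul_eq_iff, mul_smul, horbit, hσ]
  exact (inv_mul_eq_one.1 (h _ _ hfix)).symm

variable {σ : A → G} (hσ : ∀ g a, σ (g • a) = g * σ a)

/-- The fibre over `1` of an equivariant map to `G` is a transversal of the orbits. -/
def equivFiberOneProd : A ≃ {a // σ a = 1} × G where
  toFun a := (⟨(σ a)⁻¹ • a, by rw [hσ, inv_mul_cancel]⟩, σ a)
  invFun p := p.2 • p.1.1
  left_inv a := smul_inv_smul _ _
  right_inv := by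
    rintro ⟨⟨a, ha⟩, g⟩
    simp [hσ, ha]

include hσ in
lemma card_apply_ne_one [Finite A] [Nonempty A] :
    (Nat.card {a // σ a ≠ 1} : ℚ) = Nat.card A * (1 - (Nat.card G : ℚ)⁻¹) := by
  classical
  have hprod : Nat.card A = Nat.card {a // σ a = 1} * Nat.card G := by
    rw [← Nat.card_prod, Nat.card_congr (equivFiberOneProd hσ)]
  have hsum : Nat.card {a // σ a = 1} + Nat.card {a // σ a ≠ 1} = Nat.card A := by
    rw [← Nat.card_sum, Nat.card_congr (Equiv.sumCompl fun a => σ a = 1)]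
  have hG : Nat.card G ≠ 0 := right_ne_zero_of_mul (hprod ▸ Nat.card_pos.ne')
  have hfiber : (Nat.card {a // σ a = 1} : ℚ) = Nat.card A * (Nat.card G : ℚ)⁻¹ :=
    (eq_mul_inv_iff_mul_eq₀ (Nat.cast_ne_zero.2 hG)).2 (by exact_mod_cast hprod.symm)
  have hsumQ : (Nat.card {a // σ a = 1} : ℚ) + Nat.card {a // σ a ≠ 1} = Nat.card A := by
    exact_mod_cast hsum
  linear_combination hsumQ - hfiber

end EquivariantMap

noncomputable section FreeProductAction

open Monoid Monoid.CoprodI SemidirectProduct ActionCategory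

variable {ι : Type u} {G : ι → Type u} [∀ i, Group (G i)] {A : Type u} [MulAction (CoprodI G) A]
  {X : Type u} [Group X] {σ : ∀ i, A → G i}

lemma mulAutArrow_mul_left_apply {L : Type*} [Group L] [MulAction L A]
    (x y : (A → X) ⋊[mulAutArrow] L) (b : A) :
    (x * y).left b = x.left b * y.left (x.right⁻¹ • b) := rfl

/-- The crossed homomorphism, written as a map to the semidirect product, whose restriction to
each factor is the coboundary of `l i`. -/
def crossedHom (l : ι → A → X) : CoprodI G →* (A → X) ⋊[mulAutArrow] CoprodI G :=
  CoprodI.lift fun i => (MulAut.conj (inl (l i))).toMonoidHom.comp (inr.comp of)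

lemma crossedHom_of_left (l : ι → A → X) (i : ι) (g : G i) (b : A) :
    (crossedHom (G := G) l (of g)).left b = l i b * (l i ((of g)⁻¹ • b))⁻¹ := by
  simp [crossedHom, mulAutArrow_mul_left_apply, ← map_inv]

lemma rightHom_comp_crossedHom (l : ι → A → X) :
    rightHom.comp (crossedHom (G := G) l) = MonoidHom.id (CoprodI G) :=
  CoprodI.ext_hom _ _ fun i => MonoidHom.ext fun g => by simp [crossedHom]

variable (hσ : ∀ i (g : G i) b, σ i (of g • b) = g * σ i b)

include hσ in
theorem existsUnique_crossedHom (l : ι → A → X) (hl : ∀ i b, σ i b = 1 → l i b = 1) :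
    ∃! φ : CoprodI G →* (A → X) ⋊[mulAutArrow] CoprodI G,
      rightHom.comp φ = MonoidHom.id _ ∧ ∀ i b, (φ (of (σ i b))).left b = l i b := by
  refine ⟨crossedHom l, ⟨rightHom_comp_crossedHom l, fun i b => ?_⟩, ?_⟩
  · have hbase : σ i ((of (σ i b))⁻¹ • b) = 1 := by rw [← map_inv, hσ, inv_mul_cancel]
    rw [crossedHom_of_left, hl i _ hbase, inv_one, mul_one]
  · rintro φ ⟨hright, hleft⟩
    refine CoprodI.ext_hom _ _ fun i => MonoidHom.ext fun g => SemidirectProduct.ext ?_ ?_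
    · funext b
      have hright' : (φ (of g)).right = of g := DFunLike.congr_fun hright (of g)
      have hfactor : σ i b = g * σ i ((of g)⁻¹ • b) := by
        rw [← map_inv, hσ, mul_inv_cancel_left]
      have hcocycle : l i b = (φ (of g)).left b * l i ((of g)⁻¹ • b) := by
        rw [← hleft, hfactor, map_mul, map_mul, mulAutArrow_mul_left_apply, hright', hleft]
      simp only [MonoidHom.comp_apply]
      rw [crossedHom_of_left, hcocycle, mul_inv_cancel_right]
    · exact (DFunLike.congr_fun hright (of g)).trans
        (DFunLike.congr_fun (rightHom_comp_crossedHom l) (of g)).symm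

/-- The quiver of generating arrows of the action groupoid of a free product: inside each orbit
of a factor, the arrows that join the point where `σ i` is trivial to the other points. -/
abbrev coprodActionQuiver (σ : ∀ i, A → G i) :
    Quiver.{u} (IsFreeGroupoid.Generators (ActionCategory (CoprodI G) A)) where
  Hom a b := {i : ι // σ i (ActionCategory.back (M := CoprodI G) b) ≠ 1 ∧
    of (σ i (ActionCategory.back (M := CoprodI G) b)) • ActionCategory.back (M := CoprodI G) a =
      ActionCategory.back (M := CoprodI G) b}

/-- If every factor acts freely, the action groupoid of a free product is free. -/
abbrev isFreeGroupoidCoprodAction : IsFreeGroupoid (ActionCategory (CoprodI G) A) where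
  quiverGenerators := coprodActionQuiver σ
  of e := ⟨of (σ e.1 _), e.2.2⟩
  unique_lift := by
    classical
    intro X _ f
    let l : ι → A → X := fun i b =>
      if h : σ i b ≠ 1 then @f ⟨(), (of (σ i b))⁻¹ • b⟩ ⟨(), b⟩ ⟨i, h, smul_inv_smul _ b⟩ else 1
    have hl_one (i b) (h : σ i b = 1) : l i b = 1 := dif_neg (not_not_intro h)
    have hl_arrow (i b) (h : σ i b ≠ 1) :
        l i b = @f ⟨(), (of (σ i b))⁻¹ • b⟩ ⟨(), b⟩ ⟨i, h, smul_inv_smul _ b⟩ := dif_pos h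
    obtain ⟨φ, ⟨hright, hleft⟩, hunique⟩ := existsUnique_crossedHom hσ l hl_one
    refine ⟨uncurry φ fun x => DFunLike.congr_fun hright x, ?_, fun F hF => ?_⟩
    · rintro ⟨⟨⟩, a : A⟩ ⟨⟨⟩, b : A⟩ ⟨i, h : σ i b ≠ 1, hab : of (σ i b) • a = b⟩
      cases inv_smul_eq_iff.2 hab.symm
      exact (hleft i b).trans (hl_arrow i b h)
    · have hcurry : curry F = φ := by
        refine hunique _ ⟨rfl, fun i b => ?_⟩
        by_cases h : σ i b = 1
        · rw [hl_one i b h, h, map_one, map_one]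
          rfl
        · exact (hF ⟨(), (of (σ i b))⁻¹ • b⟩ ⟨(), b⟩ ⟨i, h, smul_inv_smul _ b⟩).trans
            (hl_arrow i b h).symm
      subst hcurry
      exact Functor.hext (fun _ => rfl) (ActionCategory.cases fun _ _ => HEq.rfl)

/-- A generating arrow is determined by its factor and its target. -/
def totalCoprodActionQuiverEquiv (σ : ∀ i, A → G i) :
    @Quiver.Total (IsFreeGroupoid.Generators (ActionCategory (CoprodI G) A))
      (coprodActionQuiver σ) ≃ Σ i, {b : A // σ i b ≠ 1} :=
  letI := coprodActionQuiver σ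
  { toFun e := ⟨e.hom.1, ActionCategory.back (M := CoprodI G) e.right, e.hom.2.1⟩
    invFun p := ⟨⟨(), (of (σ p.1 p.2.1))⁻¹ • p.2.1⟩, ⟨(), p.2.1⟩, ⟨p.1, p.2.2, smul_inv_smul _ _⟩⟩
    left_inv := by
      rintro ⟨⟨⟨⟩, a : A⟩, ⟨⟨⟩, b⟩, ⟨i, h : σ i b ≠ 1, hab : of (σ i b) • a = b⟩⟩
      cases inv_smul_eq_iff.2 hab.symm
      rfl
    right_inv := fun _ => rfl }

lemma exists_equivariant_factors
    (hfree : ∀ i (g : G i) (a : A), (of g : CoprodI G) • a = a → g = 1) :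
    ∃ σ : ∀ i, A → G i, ∀ i (g : G i) b, σ i ((of g : CoprodI G) • b) = g * σ i b := by
  have hex (i : ι) : ∃ σ : A → G i, ∀ (g : G i) b, σ ((of g : CoprodI G) • b) = g * σ b :=
    letI : MulAction (G i) A := MulAction.compHom A (of : G i →* CoprodI G)
    exists_equivariant_of_free (hfree i)
  exact Classical.skolem.1 hex

include hσ in
lemma card_factor_apply_ne_one [Finite A] [Nonempty A] (i : ι) :
    (Nat.card {a // σ i a ≠ 1} : ℚ) = Nat.card A * (1 - (Nat.card (G i) : ℚ)⁻¹) :=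
  letI : MulAction (G i) A := MulAction.compHom A (of : G i →* CoprodI G)
  card_apply_ne_one (hσ i)

/-- A case of Kurosh's subgroup theorem, with the rank. -/
theorem exists_subgroup_mulEquiv_freeGroup [Fintype ι] (H : Subgroup (CoprodI G)) [H.FiniteIndex]
    (hH : ∀ i (g : G i) (x : CoprodI G), x⁻¹ * of g * x ∈ H → g = 1) :
    ∃ k : ℕ, (k : ℚ) = 1 + H.index * (∑ i, (1 - (Nat.card (G i) : ℚ)⁻¹) - 1) ∧
      Nonempty (H ≃* FreeGroup (Fin k)) := by
  have hfree (i) (g : G i) (a : CoprodI G ⧸ H) (h : (of g : CoprodI G) • a = a) : g = 1 := by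
    induction a using QuotientGroup.induction_on with
    | H x => exact inv_eq_one.1 (hH i g⁻¹ x (by simpa [mul_assoc] using QuotientGroup.eq.1 h))
  obtain ⟨σ, hσ⟩ := exists_equivariant_factors hfree
  let _ := isFreeGroupoidCoprodAction hσ
  have : Finite (ActionCategory (CoprodI G) (CoprodI G ⧸ H)) :=
    Finite.of_equiv _ (objEquiv (CoprodI G) (CoprodI G ⧸ H))
  let e := totalCoprodActionQuiverEquiv σ
  have : Finite (Quiver.Total (IsFreeGroupoid.Generators
      (ActionCategory (CoprodI G) (CoprodI G ⧸ H)))) := Finite.of_equiv _ e.symm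
  have hconn : IsConnected (ActionCategory (CoprodI G) (CoprodI G ⧸ H)) := inferInstance
  have : @IsConnected (ActionCategory (CoprodI G) (CoprodI G ⧸ H)) Groupoid.toCategory := hconn
  obtain ⟨k, hk, ⟨f⟩⟩ := exists_end_mulEquiv_freeGroup
    (objEquiv (CoprodI G) (CoprodI G ⧸ H) ((1 : CoprodI G) : CoprodI G ⧸ H))
  refine ⟨k, ?_, ⟨(endMulEquivSubgroup H).symm.trans f⟩⟩
  rw [Nat.card_congr e, ← Nat.card_congr (objEquiv (CoprodI G) (CoprodI G ⧸ H)),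
    Nat.card_sigma] at hk
  have hkQ : (k : ℚ) + H.index = ∑ i, H.index * (1 - (Nat.card (G i) : ℚ)⁻¹) + 1 := by
    simp_rw [Subgroup.index, ← card_factor_apply_ne_one hσ]
    exact_mod_cast hk
  rw [mul_sub, Finset.mul_sum]
  linear_combination hkQ

theorem exists_ker_mulEquiv_freeGroup [Fintype ι] {Q : Type*} [Group Q] [Finite Q]
    (f : CoprodI G →* Q) (hf : ∀ i, Function.Injective (f.comp (of : G i →* CoprodI G))) :
    ∃ k : ℕ, (k : ℚ) = 1 + Nat.card f.range * (∑ i, (1 - (Nat.card (G i) : ℚ)⁻¹) - 1) ∧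
      Nonempty (f.ker ≃* FreeGroup (Fin k)) := by
  rw [← Subgroup.index_ker]
  refine exists_subgroup_mulEquiv_freeGroup f.ker fun i g x hx => ?_
  have hconj : (f x)⁻¹ * f (of g) * (f x)⁻¹⁻¹ = 1 := by
    simpa using MonoidHom.mem_ker.1 hx
  exact (injective_iff_map_eq_one _).1 (hf i) g (conj_eq_one_iff.1 hconj)

end FreeProductAction

noncomputable section RotationGroup

open Monoid

variable {m : ℕ} {H : Type*} [Group H]

/-- The free product of `m` copies of the cyclic group of order three. -/
abbrev RotationGroup (m : ℕ) : Type := CoprodI fun _ : Fin m => Multiplicative (ZMod 3)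

/-- The chosen generator of the `k`-th factor. -/
def rotationGen (k : Fin m) : RotationGroup m := CoprodI.of (i := k) (Multiplicative.ofAdd 1)

lemma rotationGen_pow_three (k : Fin m) : rotationGen k ^ 3 = 1 := by
  rw [rotationGen, ← map_pow, show Multiplicative.ofAdd (1 : ZMod 3) ^ 3 = 1 by decide, map_one]

lemma mem_zpowers_ofAdd_one (n : ℕ) (x : Multiplicative (ZMod n)) :
    x ∈ Subgroup.zpowers (Multiplicative.ofAdd (1 : ZMod n)) :=
  Subgroup.mem_zpowers_iff.2 ⟨x.toAdd.cast, by simp [← ofAdd_zsmul]⟩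

/-- The homomorphism with prescribed images, of order dividing three, of the rotations. -/
def rotationLift (f : Fin m → H) (hf : ∀ k, f k ^ 3 = 1) : RotationGroup m →* H :=
  CoprodI.lift fun k => monoidHomOfForallMemZpowers (mem_zpowers_ofAdd_one 3) (g' := f k) <| by
    rw [orderOf_ofAdd_eq_addOrderOf, ZMod.addOrderOf_one]
    exact orderOf_dvd_of_pow_eq_one (hf k)

lemma rotationLift_gen (f : Fin m → H) (hf : ∀ k, f k ^ 3 = 1) (k : Fin m) :
    rotationLift f hf (rotationGen k) = f k := by
  rw [rotationLift, rotationGen, CoprodI.lift_of, monoidHomOfForallMemZpowers_apply_gen]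

lemma rotationGroup_hom_ext {φ ψ : RotationGroup m →* H}
    (h : ∀ k, φ (rotationGen k) = ψ (rotationGen k)) : φ = ψ :=
  CoprodI.ext_hom _ _ fun k =>
    (MonoidHom.eq_iff_eq_on_generator (mem_zpowers_ofAdd_one 3) _ _).2 (h k)


/-- The products `ρ₀ ⋯ ρ_{i-1}` of rotations; they correspond to `y_0 y_i` in the triplet group. -/
def rotationProd (m : ℕ) : Fin (m + 1) → RotationGroup m := Fin.partialProd rotationGen

lemma rotationProd_succ (k : Fin m) :
    rotationProd m k.succ = rotationProd m k.castSucc * rotationGen k :=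
  Fin.partialProd_succ _ _

/-- The automorphism of the rotation group that corresponds to conjugation by the reflection
`y_0`. -/
def reflectionHom (m : ℕ) : RotationGroup m →* RotationGroup m :=
  rotationLift
    (fun k => rotationProd m k.castSucc * (rotationGen k)⁻¹ * (rotationProd m k.castSucc)⁻¹)
    fun k => by rw [conj_pow, inv_pow, rotationGen_pow_three, inv_one, mul_one, mul_inv_cancel]

lemma reflectionHom_rotationProd (i : Fin (m + 1)) :
    reflectionHom m (rotationProd m i) = (rotationProd m i)⁻¹ := by
  induction i using Fin.induction with
  | zero => simp [rotationProd]
  | succ k ih => rw [rotationProd_succ, map_mul, ih, reflectionHom, rotationLift_gen]; group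

lemma reflectionHom_involutive (m : ℕ) : Function.Involutive (reflectionHom m) := by
  suffices h : (reflectionHom m).comp (reflectionHom m) = MonoidHom.id _ from
    DFunLike.congr_fun h
  refine rotationGroup_hom_ext fun k => ?_
  have hgen : reflectionHom m (rotationGen k) =
      rotationProd m k.castSucc * (rotationGen k)⁻¹ * (rotationProd m k.castSucc)⁻¹ :=
    rotationLift_gen ..
  simp only [MonoidHom.comp_apply, MonoidHom.id_apply, hgen, map_mul, map_inv,
    reflectionHom_rotationProd]
  group

/-- The permutation of the rotation group through which `y_i` acts on it: translation by `y_i y_0`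
after the reflection `y_0`. -/
def reflectionPerm (i : Fin (m + 1)) : Equiv.Perm (RotationGroup m) :=
  Function.Involutive.toPerm (fun w => (rotationProd m i)⁻¹ * reflectionHom m w) fun w => by
    beta_reduce
    rw [map_mul, map_inv, reflectionHom_rotationProd, reflectionHom_involutive, inv_inv,
      inv_mul_cancel_left]

lemma reflectionPerm_mul_self (i : Fin (m + 1)) : reflectionPerm i * reflectionPerm i = 1 :=
  Equiv.ext (Function.Involutive.toPerm_involutive _)

lemma reflectionPerm_mul_succ (k : Fin m) :
    reflectionPerm k.castSucc * reflectionPerm k.succ =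
      MulAction.toPermHom (RotationGroup m) (RotationGroup m) (rotationGen k) := by
  ext w
  change (rotationProd m k.castSucc)⁻¹ *
    reflectionHom m ((rotationProd m k.succ)⁻¹ * reflectionHom m w) = rotationGen k * w
  rw [map_mul, map_inv, reflectionHom_rotationProd, reflectionHom_involutive, inv_inv, ← mul_assoc,
    rotationProd_succ, inv_mul_cancel_left]

end RotationGroup

noncomputable section TripletGroup

open Monoid

variable {m : ℕ} {H : Type*} [Group H]

lemma mul_pow_three_eq_one_iff {x y : H} (hx : x * x = 1) (hy : y * y = 1) :
    (x * y) ^ 3 = 1 ↔ x * y * x = y * x * y := by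
  have hinv : (y * x * y)⁻¹ = y * x * y := by
    rw [mul_inv_rev, mul_inv_rev, inv_eq_of_mul_eq_one_left hx, inv_eq_of_mul_eq_one_left hy,
      mul_assoc]
  rw [← mul_inv_eq_one (a := x * y * x), hinv]
  simp only [pow_succ, pow_zero, one_mul, mul_assoc]

/-- The generator `y_i` of the triplet group. -/
def tripletGen (i : Fin (m + 1)) : TripletGroup (m + 2) := PresentedGroup.of i

lemma tripletGen_mul_self (i : Fin (m + 1)) : tripletGen i * tripletGen i = 1 := by
  rw [← pow_two]
  exact PresentedGroup.one_of_mem (rels := tripletRels (m + 2)) (.inl ⟨i, rfl⟩)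

lemma tripletGen_mul_succ_pow_three (k : Fin m) :
    (tripletGen k.castSucc * tripletGen k.succ) ^ 3 = 1 :=
  (mul_pow_three_eq_one_iff (tripletGen_mul_self _) (tripletGen_mul_self _)).2 <|
    mul_inv_eq_one.1 <| PresentedGroup.one_of_mem (rels := tripletRels (m + 2))
      (.inr ⟨k.castSucc, k.succ, by simp, rfl⟩)

lemma closure_range_tripletGen (m : ℕ) :
    Subgroup.closure (Set.range (tripletGen (m := m))) = ⊤ :=
  PresentedGroup.closure_range_of _

/-- The universal property of the triplet group, with the braid relations in Coxeter form. -/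
def tripletLift (f : Fin (m + 1) → H) (hsq : ∀ i, f i * f i = 1)
    (hcube : ∀ k : Fin m, (f k.castSucc * f k.succ) ^ 3 = 1) : TripletGroup (m + 2) →* H :=
  PresentedGroup.toGroup (f := f) <| by
    rintro _ (⟨i, rfl⟩ | ⟨i, j, hij, rfl⟩)
    · rw [map_pow, FreeGroup.lift_apply_of, pow_two, hsq]
    · obtain ⟨k, rfl, rfl⟩ : ∃ k : Fin m, i = k.castSucc ∧ j = k.succ :=
        ⟨⟨i, by omega⟩, rfl, Fin.ext hij.symm⟩
      simp only [map_mul, map_inv, FreeGroup.lift_apply_of]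
      exact mul_inv_eq_one.2 ((mul_pow_three_eq_one_iff (hsq _) (hsq _)).1 (hcube k))

lemma tripletLift_gen (f : Fin (m + 1) → H) (hsq : ∀ i, f i * f i = 1)
    (hcube : ∀ k : Fin m, (f k.castSucc * f k.succ) ^ 3 = 1) (i : Fin (m + 1)) :
    tripletLift f hsq hcube (tripletGen i) = f i :=
  PresentedGroup.toGroup.of _

lemma tripletToPerm_gen (i : Fin (m + 1)) :
    tripletToPerm (m + 2) (tripletGen i) = Equiv.swap i.castSucc i.succ :=
  PresentedGroup.toGroup.of _

lemma tripletToPerm_surjective (m : ℕ) : Function.Surjective (tripletToPerm (m + 2)) := by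
  rw [← MonoidHom.mrange_eq_top, eq_top_iff, ← Equiv.Perm.mclosure_swap_castSucc_succ (m + 1),
    Submonoid.closure_le]
  rintro _ ⟨i, rfl⟩
  exact ⟨tripletGen i, tripletToPerm_gen i⟩

/-- The parity of an element of the triplet group. -/
def tripletSign (m : ℕ) : TripletGroup (m + 2) →* ℤˣ :=
  Equiv.Perm.sign.comp (tripletToPerm (m + 2))

lemma tripletSign_gen (i : Fin (m + 1)) : tripletSign m (tripletGen i) = -1 := by
  rw [tripletSign, MonoidHom.comp_apply, tripletToPerm_gen,
    Equiv.Perm.sign_swap (Fin.castSucc_lt_succ).ne]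

/-- The homomorphism that sends the rotations to the products `y_k y_{k+1}`. -/
def rotationToTriplet (m : ℕ) : RotationGroup m →* TripletGroup (m + 2) :=
  rotationLift (fun k => tripletGen k.castSucc * tripletGen k.succ) tripletGen_mul_succ_pow_three

lemma rotationToTriplet_gen (k : Fin m) :
    rotationToTriplet m (rotationGen k) = tripletGen k.castSucc * tripletGen k.succ :=
  rotationLift_gen ..

lemma rotationToTriplet_rotationProd (i : Fin (m + 1)) :
    rotationToTriplet m (rotationProd m i) = tripletGen 0 * tripletGen i := by
  induction i using Fin.induction with
  | zero => simp [rotationProd, tripletGen_mul_self]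
  | succ k ih =>
    rw [rotationProd_succ, map_mul, ih, rotationToTriplet_gen, mul_assoc,
      ← mul_assoc (tripletGen k.castSucc), tripletGen_mul_self, one_mul]

/-- The action of the triplet group on its rotation group. -/
def tripletToRotationPerm (m : ℕ) : TripletGroup (m + 2) →* Equiv.Perm (RotationGroup m) :=
  tripletLift reflectionPerm reflectionPerm_mul_self fun k => by
    rw [reflectionPerm_mul_succ, ← map_pow, rotationGen_pow_three, map_one]

lemma tripletToRotationPerm_comp_rotationToTriplet (m : ℕ) :
    (tripletToRotationPerm m).comp (rotationToTriplet m) = MulAction.toPermHom _ _ :=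
  rotationGroup_hom_ext fun k => by
    rw [MonoidHom.comp_apply, rotationToTriplet_gen, map_mul, tripletToRotationPerm,
      tripletLift_gen, tripletLift_gen, reflectionPerm_mul_succ]

theorem rotationToTriplet_injective (m : ℕ) : Function.Injective (rotationToTriplet m) := by
  refine Function.Injective.of_comp (f := tripletToRotationPerm m) ?_
  rw [← MonoidHom.coe_comp, tripletToRotationPerm_comp_rotationToTriplet]
  exact MulAction.toPerm_injective

lemma tripletSign_rotationToTriplet (w : RotationGroup m) :
    tripletSign m (rotationToTriplet m w) = 1 := by
  have h : (tripletSign m).comp (rotationToTriplet m) = 1 := rotationGroup_hom_ext fun k => by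
    rw [MonoidHom.comp_apply, rotationToTriplet_gen, map_mul, tripletSign_gen, tripletSign_gen]
    rfl
  exact DFunLike.congr_fun h w

lemma mem_range_or_mul_gen_zero_mem_range (g : TripletGroup (m + 2)) :
    g ∈ (rotationToTriplet m).range ∨ g * tripletGen 0 ∈ (rotationToTriplet m).range := by
  have hinv (i : Fin (m + 1)) : (tripletGen i)⁻¹ = tripletGen i :=
    inv_eq_of_mul_eq_one_left (tripletGen_mul_self i)
  have hgen (i : Fin (m + 1)) : tripletGen 0 * tripletGen i ∈ (rotationToTriplet m).range :=
    ⟨rotationProd m i, rotationToTriplet_rotationProd i⟩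
  have hstep (x : TripletGroup (m + 2)) (i : Fin (m + 1))
      (hx : x ∈ (rotationToTriplet m).range ∨ x * tripletGen 0 ∈ (rotationToTriplet m).range) :
      x * tripletGen i ∈ (rotationToTriplet m).range ∨
        x * tripletGen i * tripletGen 0 ∈ (rotationToTriplet m).range := by
    rcases hx with hx | hx
    · right
      simpa [hinv, mul_assoc] using mul_mem hx (inv_mem (hgen i))
    · left
      rw [← hinv 0] at hx
      simpa [mul_assoc] using mul_mem hx (hgen i)
  have hg : g ∈ Subgroup.closure (Set.range tripletGen) := by
    rw [closure_range_tripletGen]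
    exact Subgroup.mem_top g
  induction hg using Subgroup.closure_induction_right with
  | one => exact .inl (one_mem _)
  | mul_right x _ _ hy hx =>
    obtain ⟨i, rfl⟩ := hy
    exact hstep x i hx
  | mul_inv_cancel x _ _ hy hx =>
    obtain ⟨i, rfl⟩ := hy
    rw [hinv]
    exact hstep x i hx

theorem range_rotationToTriplet (m : ℕ) : (rotationToTriplet m).range = (tripletSign m).ker := by
  refine le_antisymm ?_ fun g hg => ?_
  · rintro _ ⟨w, rfl⟩
    exact tripletSign_rotationToTriplet w
  · rcases mem_range_or_mul_gen_zero_mem_range g with h | ⟨w, hw⟩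
    · exact h
    · have hodd := tripletSign_rotationToTriplet w
      rw [hw, map_mul, MonoidHom.mem_ker.1 hg, tripletSign_gen] at hodd
      exact absurd hodd (by decide)

/-- The permutation representation of the rotation group. -/
def rotationToPerm (m : ℕ) : RotationGroup m →* Equiv.Perm (Fin (m + 2)) :=
  (tripletToPerm (m + 2)).comp (rotationToTriplet m)

lemma range_rotationToPerm (m : ℕ) : (rotationToPerm m).range = alternatingGroup (Fin (m + 2)) := by
  rw [rotationToPerm, MonoidHom.range_comp, range_rotationToTriplet, tripletSign,
    ← MonoidHom.comap_ker,
    Subgroup.map_comap_eq_self_of_surjective (tripletToPerm_surjective m)]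
  rfl

lemma two_mul_card_range_rotationToPerm (m : ℕ) :
    2 * Nat.card (rotationToPerm m).range = (m + 2).factorial := by
  rw [range_rotationToPerm, two_mul_nat_card_alternatingGroup, Nat.card_perm, Nat.card_fin]

lemma rotationToPerm_gen_ne_one (k : Fin m) : rotationToPerm m (rotationGen k) ≠ 1 := by
  rw [rotationToPerm, MonoidHom.comp_apply, rotationToTriplet_gen, map_mul, tripletToPerm_gen,
    tripletToPerm_gen]
  intro h
  have hval : (k : ℕ) = k + 1 + 1 := by
    simpa [Fin.ext_iff] using DFunLike.congr_fun h k.succ.succ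
  omega

lemma rotationToPerm_comp_of_injective (k : Fin m) :
    Function.Injective ((rotationToPerm m).comp (CoprodI.of (i := k))) := by
  have hgen : ∀ g : Multiplicative (ZMod 3),
      g = 1 ∨ g = .ofAdd 1 ∨ g = (.ofAdd 1 : Multiplicative (ZMod 3))⁻¹ := by decide
  refine (injective_iff_map_eq_one _).2 fun g hg => (hgen g).resolve_right ?_
  rintro (rfl | rfl)
  · exact rotationToPerm_gen_ne_one k hg
  · rw [map_inv, inv_eq_one] at hg
    exact rotationToPerm_gen_ne_one k hg

end TripletGroup

section PureTripletGroup

variable {L N Q : Type*} [Group L] [Group N] [Group Q]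

/-- The kernel of `f` pulled back along an injection whose range contains it. -/
noncomputable def kerCompMulEquiv (f : L →* Q) (j : N →* L) (hj : Function.Injective j)
    (hker : f.ker ≤ j.range) : (f.comp j).ker ≃* f.ker :=
  ((f.comp j).ker.equivMapOfInjective j hj).trans <| MulEquiv.subgroupCongr <| by
    rw [← MonoidHom.comap_ker, Subgroup.map_comap_eq_self hker]

lemma nonempty_rotationToPerm_ker_mulEquiv (m : ℕ) :
    Nonempty ((rotationToPerm m).ker ≃* PureTripletGroup (m + 2)) :=
  ⟨kerCompMulEquiv _ _ (rotationToTriplet_injective m) <| by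
    rw [range_rotationToTriplet, tripletSign, ← MonoidHom.comap_ker]
    exact MonoidHom.ker_le_comap _ _⟩

end PureTripletGroup

theorem proposition4p11_general (n : ℕ) (hn : 2 ≤ n) :
    ∃ r : ℕ, (r : ℚ) = 1 + (n.factorial : ℚ) * ((2 * (n : ℚ) - 7) / 6) ∧
      Nonempty (PureTripletGroup n ≃* FreeGroup (Fin r)) := by
  obtain ⟨m, rfl⟩ := Nat.exists_eq_add_of_le' hn
  obtain ⟨r, hr, ⟨e⟩⟩ :=
    exists_ker_mulEquiv_freeGroup (rotationToPerm m) rotationToPerm_comp_of_injective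
  obtain ⟨e'⟩ := nonempty_rotationToPerm_ker_mulEquiv m
  refine ⟨r, ?_, ⟨e'.symm.trans e⟩⟩
  rw [hr, ← two_mul_card_range_rotationToPerm, Finset.sum_const, Finset.card_univ,
    Fintype.card_fin, Nat.card_congr Multiplicative.toAdd, Nat.card_zmod]
  push_cast
  ring

lemma nonempty_pureTripletGroup_mulEquiv_freeGroup {n r : ℕ} (hn : 2 ≤ n)
    (hr : (r : ℚ) = 1 + (n.factorial : ℚ) * ((2 * (n : ℚ) - 7) / 6)) :
    Nonempty (PureTripletGroup n ≃* FreeGroup (Fin r)) := by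
  obtain ⟨k, hk, h⟩ := proposition4p11_general n hn
  rwa [Nat.cast_injective (R := ℚ) (hr.trans hk.symm)]

theorem proposition4p11 :
    (∀ n : ℕ, 4 ≤ n →
      ∃ r : ℕ, (r : ℚ) = 1 + (n.factorial : ℚ) * ((2 * (n : ℚ) - 7) / 6) ∧
        Nonempty (PureTripletGroup n ≃* FreeGroup (Fin r))) ∧
    Nonempty (PureTripletGroup 4 ≃* FreeGroup (Fin 5)) ∧
    Nonempty (PureTripletGroup 5 ≃* FreeGroup (Fin 61)) := by
  exact ⟨fun n hn => proposition4p11_general n (by omega),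
    nonempty_pureTripletGroup_mulEquiv_freeGroup (by norm_num) (by norm_num [Nat.factorial]),
    nonempty_pureTripletGroup_mulEquiv_freeGroup (by norm_num) (by norm_num [Nat.factorial])⟩
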